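/- Let $d\ge 1$ be an integer, $q=e^{2\pi i/d}$, and let $PF_\infty$ be the unital complex $*$-algebra generated by $c_1,c_2,\dots$ with relations $c_jc_k=q\,c_kc_j$ for $j<k$, $c_j^d=1$, $c_j^*=c_j^{-1}$. Let $\alpha$ be the unital $*$-endomorphism of $PF_\infty$ with $\alpha(c_j)=c_{j+2}$. Let $b^{(2)}_k=d^{-1/2}\sum_{i=0}^{d-1}c_k^{\,i}c_{k+1}^{-i}$ (the two-string braids, which are unitary; their overall phase is irrelevant below), let $b_j=b^{(2)}_{2j}\,b^{(2)}_{2j-1}\,b^{(2)}_{2j+1}\,b^{(2)}_{2j}$ for $j\ge1$ (the four-string braids), and let $\mathbb B_\infty$ be the group generated by the unitaries $b_j$, $j\ge 1$. Let $\varphi$ be a state on $PF_\infty$ (a linear functional with $\varphi(x^*x)\ge0$ for all $x$ and $\varphi(1)=1$) which is braid-invariant, i.e. $\varphi(bxb^{-1})=\varphi(x)$ for all $b\in\mathbb B_\infty$ and $x\in PF_\infty$. Let $(\mathcal H,\pi,\Omega)$ be its GNS representation. Define the tail algebra $$PF^T=\bigcap_{n\ge0}\pi\bigl(\alpha^n(PF_\infty)\bigr)''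 ,$$ the intersection over $n$ of the von Neumann algebras on $\mathcal H$ generated by $\pi(c_j)$, $j>2n$, and for $\ell\in\mathbb Z_d$ let $$PF^{T,\ell}=\{x\in PF^T:\ \pi(c_1)\,x\,\pi(c_1)^{-1}=q^{\ell}x\}$$ be its part of charge $\ell$; $PF^{T,0}$ is the neutral part. Let $p_0$ be the smallest positive integer with $d\mid p_0^2$. If $PF^{T,0}=\mathbb C 1$, then there is a positive integer $m_0$ with $p_0\mid m_0$ and $m_0\mid d$ such that $$PF^T=\bigoplus_{j=1}^{d/m_0}PF^{T,jm_0},$$ and, for every $1\le j\le d/m_0$, $PF^{T,jm_0}$ is one-dimensional and is spanned by a unitary element of $PF^T$. -/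

import Mathlib

open scoped ComplexOrder InnerProductSpace

noncomputable section

namespace Parafermion

/-! ### The parafermion algebra of order `d` -/

/-- The primitive `d`-th root of unity `q = e^{2πi/d}`. -/
def q (d : ℕ) : ℂ := Complex.exp (2 * Real.pi * Complex.I / d)

/-- The canonical parafermion relations on the free algebra with generators indexed by `ℕ`
(the index `j` stands for the `(j+1)`-st parafermion). The remaining relation `c_j^* = c_j^{-1}`
is the definition of the involution below. -/
inductive Rel (d : ℕ) : FreeAlgebra ℂ ℕ → FreeAlgebra ℂ ℕ → Prop
  | comm {j k : ℕ} (h : j < k) :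
      Rel d (FreeAlgebra.ι ℂ j * FreeAlgebra.ι ℂ k)
        (q d • (FreeAlgebra.ι ℂ k * FreeAlgebra.ι ℂ j))
  | pow (j : ℕ) : Rel d (FreeAlgebra.ι ℂ j ^ d) 1

/-- The infinite parafermion algebra of order `d`. -/
def PF (d : ℕ) : Type := RingQuot (Rel d)

namespace PF

variable {d : ℕ}

instance : Ring (PF d) := inferInstanceAs (Ring (RingQuot (Rel d)))
instance : Algebra ℂ (PF d) := inferInstanceAs (Algebra ℂ (RingQuot (Rel d)))

/-- The quotient map from the free algebra. -/
def mk (d : ℕ) : FreeAlgebra ℂ ℕ →ₐ[ℂ] PF d := RingQuot.mkAlgHom ℂ (Rel d)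

/-- The parafermion generators. -/
def c (d : ℕ) (j : ℕ) : PF d := mk d (FreeAlgebra.ι ℂ j)

theorem c_mul_c {j k : ℕ} (h : j < k) : c d j * c d k = q d • (c d k * c d j) := by
  have := RingQuot.mkAlgHom_rel ℂ (Rel.comm (d := d) h)
  rw [map_mul, map_smul, map_mul] at this
  exact this

theorem c_pow (j : ℕ) : c d j ^ d = 1 := by
  have := RingQuot.mkAlgHom_rel ℂ (Rel.pow (d := d) j)
  rw [map_pow, map_one] at this
  exact this

/-- The universal property of the parafermion algebra. -/
def lift {A : Type*} [Ring A] [Algebra ℂ A] (f : ℕ → A)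
    (hcomm : ∀ j k, j < k → f j * f k = q d • (f k * f j)) (hpow : ∀ j, f j ^ d = 1) :
    PF d →ₐ[ℂ] A :=
  RingQuot.liftAlgHom ℂ ⟨FreeAlgebra.lift ℂ f, by
    intro x y h
    cases h with
    | comm h => simpa using hcomm _ _ h
    | pow j => simpa using hpow j⟩

@[simp]
theorem lift_c {A : Type*} [Ring A] [Algebra ℂ A] (f : ℕ → A)
    (hcomm : ∀ j k, j < k → f j * f k = q d • (f k * f j)) (hpow : ∀ j, f j ^ d = 1) (j : ℕ) :
    lift f hcomm hpow (c d j) = f j := by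
  unfold lift c mk
  erw [RingQuot.liftAlgHom_mkAlgHom_apply]
  simp

theorem induction {P : PF d → Prop} (halg : ∀ r : ℂ, P (algebraMap ℂ (PF d) r))
    (hc : ∀ j, P (c d j)) (hmul : ∀ a b, P a → P b → P (a * b))
    (hadd : ∀ a b, P a → P b → P (a + b)) (a : PF d) : P a := by
  obtain ⟨x, rfl⟩ : ∃ x, mk d x = a := RingQuot.mkAlgHom_surjective ℂ (Rel d) a
  induction x using FreeAlgebra.induction with
  | grade0 r => simpa using halg r
  | grade1 j => exact hc j
  | mul a b ha hb => simpa using hmul _ _ ha hb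
  | add a b ha hb => simpa using hadd _ _ ha hb

theorem algHom_ext {A : Type*} [Ring A] [Algebra ℂ A] {f g : PF d →ₐ[ℂ] A}
    (h : ∀ j, f (c d j) = g (c d j)) : f = g := by
  ext a
  induction a using PF.induction with
  | halg r => simp
  | hc j => exact h j
  | hmul a b ha hb => simp [ha, hb]
  | hadd a b ha hb => simp [ha, hb]

/-! #### The involution: conjugate-linear, order-reversing, with `c_j^* = c_j^{-1} = c_j^{d-1}` -/

/-- The opposite algebra with the conjugate scalar action. -/
def ConjOp (d : ℕ) : Type := (PF d)ᵐᵒᵖ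

instance : Ring (ConjOp d) := inferInstanceAs (Ring (PF d)ᵐᵒᵖ)

instance : Algebra ℂ (ConjOp d) :=
  @Algebra.compHom ℂ ℂ (PF d)ᵐᵒᵖ _ _ _ _ (starRingEnd ℂ)

/-- The identity map into the opposite algebra. -/
def toConjOp (a : PF d) : ConjOp d := MulOpposite.op a

/-- The identity map from the opposite algebra. -/
def ofConjOp (a : ConjOp d) : PF d := MulOpposite.unop (α := PF d) a

@[simp] theorem of_to (a : PF d) : ofConjOp (toConjOp a) = a := rfl
theorem to_mul (a b : PF d) : toConjOp a * toConjOp b = toConjOp (b * a) := rfl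
theorem of_mul (a b : ConjOp d) : ofConjOp (a * b) = ofConjOp b * ofConjOp a := rfl
theorem of_add (a b : ConjOp d) : ofConjOp (a + b) = ofConjOp a + ofConjOp b := rfl
theorem to_pow (a : PF d) (n : ℕ) : toConjOp a ^ n = toConjOp (a ^ n) := rfl
theorem to_one : toConjOp (1 : PF d) = 1 := rfl

theorem of_algebraMap (r : ℂ) :
    ofConjOp (algebraMap ℂ (ConjOp d) r) = algebraMap ℂ (PF d) (star r) := rfl

theorem to_smul (r : ℂ) (a : PF d) : r • toConjOp a = toConjOp (star r • a) := rfl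

theorem q_ne_zero : q d ≠ 0 := Complex.exp_ne_zero _

theorem star_q : star (q d) = (q d)⁻¹ := by
  simp only [q, Complex.star_def, ← Complex.exp_conj, ← Complex.exp_neg]
  congr 1
  have h2 : (starRingEnd ℂ) 2 = 2 := Complex.conj_ofNat 2
  simp [neg_div, h2]

theorem pow_mul_pow_of_comm {A : Type*} [Ring A] [Algebra ℂ A] {x y : A} {r : ℂ}
    (h : x * y = r • (y * x)) (m n : ℕ) : x ^ m * y ^ n = r ^ (m * n) • (y ^ n * x ^ m) := by
  have h1 : ∀ n : ℕ, x * y ^ n = r ^ n • (y ^ n * x) := by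
    intro n
    induction n with
    | zero => simp
    | succ n ih =>
      rw [pow_succ, ← mul_assoc, ih, smul_mul_assoc, mul_assoc, h, mul_smul_comm, smul_smul,
        ← mul_assoc, ← pow_succ]
  induction m with
  | zero => simp
  | succ m ih =>
    rw [pow_succ, mul_assoc, h1, mul_smul_comm, ← mul_assoc, ih, smul_mul_assoc, smul_smul,
      mul_assoc]
    congr 1
    ring

variable [NeZero d]

theorem isPrimitiveRoot_q : IsPrimitiveRoot (q d) d :=
  Complex.isPrimitiveRoot_exp d (NeZero.ne d)

theorem q_pow : q d ^ d = 1 := isPrimitiveRoot_q.pow_eq_one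

theorem q_pow_pred_sq : q d ^ ((d - 1) * (d - 1)) = q d := by
  obtain ⟨n, rfl⟩ : ∃ n, d = n + 1 := ⟨d - 1, by have := NeZero.ne d; omega⟩
  cases n with
  | zero => simpa using (q_pow (d := 1)).symm
  | succ n =>
    have : (n + 1 + 1 - 1) * (n + 1 + 1 - 1) = (n + 1 + 1) * n + 1 := by
      simp only [Nat.add_sub_cancel]; ring
    rw [this, pow_succ, pow_mul, q_pow]
    simp

theorem c_pow_pred_pow_pred (j : ℕ) : (c d j ^ (d - 1)) ^ (d - 1) = c d j := by
  obtain ⟨n, rfl⟩ : ∃ n, d = n + 1 := ⟨d - 1, by have := NeZero.ne d; omega⟩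
  cases n with
  | zero => simpa using (c_pow (d := 1) j).symm
  | succ n =>
    have : (n + 1 + 1 - 1) * (n + 1 + 1 - 1) = (n + 1 + 1) * n + 1 := by
      simp only [Nat.add_sub_cancel]; ring
    rw [← pow_mul, this, pow_succ, pow_mul, c_pow]
    simp

/-- The involution as an algebra homomorphism to the conjugate opposite algebra. -/
def starHom (d : ℕ) [NeZero d] : PF d →ₐ[ℂ] ConjOp d :=
  lift (fun j => toConjOp (c d j ^ (d - 1)))
    (by
      intro j k h
      rw [to_mul, to_mul, pow_mul_pow_of_comm (c_mul_c h), q_pow_pred_sq, to_smul, smul_smul,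
        star_q, inv_mul_cancel₀ q_ne_zero, one_smul])
    (by
      intro j
      rw [to_pow, ← pow_mul, mul_comm, pow_mul, c_pow, one_pow, to_one])

instance : Star (PF d) := ⟨fun a => ofConjOp (starHom d a)⟩

theorem star_def (a : PF d) : star a = ofConjOp (starHom d a) := rfl

theorem star_c (j : ℕ) : star (c d j) = c d j ^ (d - 1) := by
  simp [star_def, starHom]

theorem star_mul_aux (a b : PF d) : star (a * b) = star b * star a := by
  simp [star_def, of_mul]

theorem star_add_aux (a b : PF d) : star (a + b) = star a + star b := by
  simp [star_def, of_add]

theorem star_algebraMap_aux (r : ℂ) :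
    star (algebraMap ℂ (PF d) r) = algebraMap ℂ (PF d) (star r) := by
  rw [star_def, AlgHom.commutes, of_algebraMap]

theorem star_pow_aux (a : PF d) (n : ℕ) : star (a ^ n) = star a ^ n := by
  induction n with
  | zero => simpa using star_algebraMap_aux (d := d) 1
  | succ n ih => rw [pow_succ, star_mul_aux, ih, pow_succ']

theorem star_star_aux (a : PF d) : star (star a) = a := by
  induction a using PF.induction with
  | halg r => simp [star_algebraMap_aux]
  | hc j => rw [star_c, star_pow_aux, star_c, c_pow_pred_pow_pred]
  | hmul a b ha hb => rw [star_mul_aux, star_mul_aux, ha, hb]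
  | hadd a b ha hb => rw [star_add_aux, star_add_aux, ha, hb]

instance : StarRing (PF d) where
  star_involutive := star_star_aux
  star_mul := star_mul_aux
  star_add := star_add_aux

instance : StarModule ℂ (PF d) where
  star_smul r a := by
    rw [Algebra.smul_def, star_mul_aux, star_algebraMap_aux, Algebra.smul_def,
      Algebra.commutes]

theorem c_mem_unitary (j : ℕ) : c d j ∈ unitary (PF d) := by
  have h : d - 1 + 1 = d := Nat.sub_add_cancel (NeZero.one_le)
  rw [Unitary.mem_iff, star_c, ← pow_succ, ← pow_succ', h, c_pow]
  simp

/-! ### The four-string braids -/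

theorem sum_range_add_of_periodic {M : Type*} [AddCommGroup M] {F : ℕ → M} {d : ℕ}
    (hF : ∀ i, F (i + d) = F i) (k : ℕ) :
    ∑ i ∈ Finset.range d, F (i + k) = ∑ i ∈ Finset.range d, F i := by
  induction k with
  | zero => simp
  | succ k ih =>
    rw [← ih]
    have h1 := Finset.sum_range_succ (fun i => F (i + k)) d
    have h2 := Finset.sum_range_succ' (fun i => F (i + k)) d
    have h3 : F (d + k) = F (0 + k) := by rw [add_comm d k, hF, zero_add]
    rw [h2, h3] at h1
    have h4 := add_right_cancel h1
    rw [← h4]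
    exact Finset.sum_congr rfl fun i _ => by congr 1; ring

theorem sum_pow_mul {d : ℕ} (r : ℂ) (hr : IsPrimitiveRoot r d) {s : ℕ} (hs : s < d) :
    ∑ k ∈ Finset.range d, r ^ (k * s) = if s = 0 then (d : ℂ) else 0 := by
  split_ifs with h
  · simp [h]
  · have h1 : r ^ s ≠ 1 := hr.pow_ne_one_of_pos_of_lt h hs
    have h2 : ∑ k ∈ Finset.range d, (r ^ s) ^ k = 0 := by
      rw [geom_sum_eq h1, ← pow_mul, mul_comm, pow_mul, hr.pow_eq_one]
      simp
    rw [← h2]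
    exact Finset.sum_congr rfl fun k _ => by rw [← pow_mul, mul_comm]

/-- The two-string braid on the strings `k` and `k + 1`, namely
`d^{-1/2} ∑_i c_k^i c_{k+1}^{-i}`. The overall phase is irrelevant for the adjoint action and is
normalised to one. -/
def twoBraid (d : ℕ) [NeZero d] (k : ℕ) : PF d :=
  ((Real.sqrt d : ℝ) : ℂ)⁻¹ • ∑ i ∈ Finset.range d, c d k ^ i * star (c d (k + 1)) ^ i

theorem twoBraid_mem_unitary (k : ℕ) : twoBraid d k ∈ unitary (PF d) := by
  obtain ⟨ha, ha'⟩ := Unitary.mem_iff.mp (c_mem_unitary (d := d) k)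
  obtain ⟨he, he'⟩ := Unitary.mem_iff.mp (c_mem_unitary (d := d) (k + 1))
  have hae := c_mul_c (d := d) (Nat.lt_succ_self k)
  have had := c_pow (d := d) k
  have hed := c_pow (d := d) (k + 1)
  unfold twoBraid
  generalize c d k = a at *
  simp only [Nat.succ_eq_add_one] at *
  generalize c d (k + 1) = e at *
  have h1 : star e * a = q d • (a * star e) := by
    calc star e * a = star e * (a * e) * star e := by
          rw [mul_assoc, mul_assoc, he', mul_one]
      _ = q d • (a * star e) := by
          rw [hae, mul_smul_comm, smul_mul_assoc, ← mul_assoc, he, one_mul]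
  have h2 : a * star e = (q d)⁻¹ • (star e * a) := by
    rw [h1, smul_smul, inv_mul_cancel₀ q_ne_zero, one_smul]
  have h3 := pow_mul_pow_of_comm h2
  have hEd : star e ^ d = 1 := by rw [← star_pow, hed, star_one]
  have hee : ∀ n, star e ^ n * e ^ n = 1 := fun n => by
    have hc : Commute (star e) e := by rw [commute_iff_eq, he, he']
    rw [← hc.mul_pow, he, one_pow]
  have hee' : ∀ n, e ^ n * star e ^ n = 1 := fun n => by
    have hc : Commute e (star e) := by rw [commute_iff_eq, he, he']
    rw [← hc.mul_pow, he', one_pow]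
  have haa : ∀ n, star a ^ n * a ^ n = 1 := fun n => by
    have hc : Commute (star a) a := by rw [commute_iff_eq, ha, ha']
    rw [← hc.mul_pow, ha, one_pow]
  have haa' : ∀ n, a ^ n * star a ^ n = 1 := fun n => by
    have hc : Commute a (star a) := by rw [commute_iff_eq, ha, ha']
    rw [← hc.mul_pow, ha', one_pow]
  set F : ℕ → PF d := fun i => a ^ i * star e ^ i with hF
  have hper : ∀ i, F (i + d) = F i := fun i => by
    simp only [hF, pow_add, had, hEd, mul_one]
  have hstar : ∀ i, star (F i) = e ^ i * star a ^ i := fun i => by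
    simp [hF]
  have hL : ∀ k s, F (s + k) * star (F k) = ((q d)⁻¹ ^ (k * s)) • F s := fun k s => by
    rw [hstar]
    simp only [hF]
    calc a ^ (s + k) * star e ^ (s + k) * (e ^ k * star a ^ k)
        = a ^ s * (a ^ k * star e ^ s) * (star e ^ k * e ^ k) * star a ^ k := by
          rw [pow_add, pow_add]; noncomm_ring
      _ = _ := by
          rw [hee, mul_one, h3, mul_smul_comm, smul_mul_assoc, mul_assoc, mul_assoc, haa', mul_one]
  have hR : ∀ k s, star (F k) * F (s + k) = ((q d)⁻¹ ^ (k * s)) • F s := fun k s => by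
    rw [hstar]
    simp only [hF]
    calc e ^ k * star a ^ k * (a ^ (s + k) * star e ^ (s + k))
        = e ^ k * (star a ^ k * a ^ k) * (a ^ s * star e ^ k) * star e ^ s := by
          rw [add_comm s k, pow_add, pow_add]; noncomm_ring
      _ = _ := by
          rw [haa, mul_one, h3, mul_smul_comm, smul_mul_assoc, ← mul_assoc, hee', one_mul,
            mul_comm s k]
  have hsum : ∑ k ∈ Finset.range d, ∑ s ∈ Finset.range d, ((q d)⁻¹ ^ (k * s)) • F s
      = (d : ℂ) • (1 : PF d) := by
    rw [Finset.sum_comm]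
    have : ∀ s ∈ Finset.range d, ∑ k ∈ Finset.range d, ((q d)⁻¹ ^ (k * s)) • F s
        = if s = 0 then (d : ℂ) • (1 : PF d) else 0 := fun s hs => by
      rw [← Finset.sum_smul, sum_pow_mul _ isPrimitiveRoot_q.inv (Finset.mem_range.mp hs)]
      split_ifs with h
      · simp [hF, h]
      · simp
    rw [Finset.sum_congr rfl this, Finset.sum_ite_eq' (Finset.range d) 0]
    simp [NeZero.pos d]
  have hnorm : ((Real.sqrt d : ℝ) : ℂ)⁻¹ * ((Real.sqrt d : ℝ) : ℂ)⁻¹ * (d : ℂ) = 1 := by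
    have h0 : (0 : ℝ) < d := by exact_mod_cast NeZero.pos d
    have h5 : ((Real.sqrt d : ℝ) : ℂ) * ((Real.sqrt d : ℝ) : ℂ) = (d : ℂ) := by
      rw [← Complex.ofReal_mul, Real.mul_self_sqrt h0.le]; simp
    have h6 : ((Real.sqrt d : ℝ) : ℂ) ≠ 0 := by
      simpa using (Real.sqrt_pos.mpr h0).ne'
    rw [← h5]
    field_simp
  have hs : star (((Real.sqrt d : ℝ) : ℂ)⁻¹) = ((Real.sqrt d : ℝ) : ℂ)⁻¹ := by
    rw [star_inv₀, Complex.star_def, Complex.conj_ofReal]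
  rw [Unitary.mem_iff, star_smul, hs, star_sum, smul_mul_smul_comm, smul_mul_smul_comm]
  constructor
  · rw [Finset.sum_mul]
    simp_rw [Finset.mul_sum]
    have : ∀ k ∈ Finset.range d, ∑ i ∈ Finset.range d, star (F k) * F i
        = ∑ s ∈ Finset.range d, ((q d)⁻¹ ^ (k * s)) • F s := fun k _ => by
      rw [← sum_range_add_of_periodic (F := fun i => star (F k) * F i)
        (fun i => by rw [hper]) k]
      exact Finset.sum_congr rfl fun s _ => hR k s
    rw [Finset.sum_congr rfl this, hsum, smul_smul, hnorm, one_smul]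
  · rw [Finset.mul_sum]
    simp_rw [Finset.sum_mul]
    have : ∀ k ∈ Finset.range d, ∑ i ∈ Finset.range d, F i * star (F k)
        = ∑ s ∈ Finset.range d, ((q d)⁻¹ ^ (k * s)) • F s := fun k _ => by
      rw [← sum_range_add_of_periodic (F := fun i => F i * star (F k))
        (fun i => by rw [hper]) k]
      exact Finset.sum_congr rfl fun s _ => hL k s
    rw [Finset.sum_congr rfl this, hsum, smul_smul, hnorm, one_smul]

/-- The two-string braid as an element of the unitary group. -/
def twoBraidU (d : ℕ) [NeZero d] (k : ℕ) : unitary (PF d) := ⟨twoBraid d k, twoBraid_mem_unitary k⟩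

/-- The four-string braid which braids the pair of strings `(2j, 2j+1)` with the pair
`(2j+2, 2j+3)`, where strings are counted from zero. -/
def fourBraid (d : ℕ) [NeZero d] (j : ℕ) : unitary (PF d) :=
  twoBraidU d (2 * j + 1) * twoBraidU d (2 * j) * twoBraidU d (2 * j + 2) * twoBraidU d (2 * j + 1)

/-- The (image in the unitary group of the) braid group generated by the four-string braids. -/
def braidGroup (d : ℕ) [NeZero d] : Subgroup (unitary (PF d)) :=
  Subgroup.closure (Set.range (fourBraid d))

/-- The double shift, the unital `*`-endomorphism with `α (c_j) = c_{j+2}`. -/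
def shift (d : ℕ) [NeZero d] : PF d →⋆ₐ[ℂ] PF d where
  __ := lift (d := d) (fun j => c d (j + 2)) (fun _ _ h => c_mul_c (by omega)) (fun _ => c_pow _)
  map_star' a := by
    simp only [AlgHom.toRingHom_eq_coe, RingHom.toMonoidHom_eq_coe, OneHom.toFun_eq_coe,
      MonoidHom.toOneHom_coe, MonoidHom.coe_coe, RingHom.coe_coe]
    induction a using PF.induction with
    | halg r => rw [star_algebraMap_aux, AlgHom.commutes, AlgHom.commutes, star_algebraMap_aux]
    | hc j => rw [star_c, map_pow, lift_c, star_c]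
    | hmul a b ha hb => rw [star_mul, map_mul, ha, hb, map_mul, star_mul]
    | hadd a b ha hb => rw [star_add, map_add, ha, hb, map_add, star_add]

theorem shift_c (j : ℕ) : shift d (c d j) = c d (j + 2) :=
  lift_c (d := d) (fun j => c d (j + 2)) (fun _ _ h => c_mul_c (by omega)) (fun _ => c_pow _) j

end PF

/-! ### States and the GNS construction -/

/-- A state: a positive linear functional of norm one. -/
structure State (d : ℕ) [NeZero d] where
  toLinearMap : PF d →ₗ[ℂ] ℂ
  nonneg' : ∀ x, 0 ≤ toLinearMap (star x * x)
  map_one' : toLinearMap 1 = 1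

namespace State

variable {d : ℕ} [NeZero d]

instance : CoeFun (State d) (fun _ => PF d → ℂ) := ⟨fun φ => φ.toLinearMap⟩

/-- Invariance under the adjoint action of the braid group. -/
def BraidInvariant (φ : State d) : Prop :=
  ∀ b ∈ PF.braidGroup d, ∀ x : PF d, φ ((b : PF d) * x * star (b : PF d)) = φ x

theorem map_star (φ : State d) (x : PF d) : φ (star x) = star (φ x) := by
  have h0 := (Complex.nonneg_iff.mp (φ.nonneg' x)).2
  have h1 := (Complex.nonneg_iff.mp (φ.nonneg' (x + 1))).2
  have h2 := (Complex.nonneg_iff.mp (φ.nonneg' (x + Complex.I • 1))).2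
  have e1 : star (x + 1) * (x + 1) = star x * x + star x + x + 1 := by
    rw [star_add, star_one]; noncomm_ring
  have e2 : star (x + Complex.I • 1) * (x + Complex.I • 1)
      = star x * x + Complex.I • star x - Complex.I • x + 1 := by
    have hI : star Complex.I = -Complex.I := Complex.conj_I
    rw [star_add, star_smul, star_one, hI, add_mul, mul_add, mul_add, smul_mul_smul_comm,
      mul_smul_comm, smul_mul_assoc, mul_one, one_mul, mul_one, neg_mul, Complex.I_mul_I, neg_neg,
      one_smul, neg_smul]
    abel
  rw [e1, map_add, map_add, map_add, φ.map_one'] at h1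
  rw [e2, map_add, map_sub, map_add, map_smul, map_smul, φ.map_one'] at h2
  apply Complex.ext
  · simp at h0 h1 h2 ⊢
    linarith
  · simp at h0 h1 h2 ⊢
    linarith

/-- The algebra with the sesquilinear form `⟨x, y⟩ = φ (x^* y)`. -/
@[nolint unusedArguments]
def PreGNS (_φ : State d) : Type := PF d

variable (φ : State d)

instance : AddCommGroup φ.PreGNS := inferInstanceAs (AddCommGroup (PF d))
instance : Module ℂ φ.PreGNS := inferInstanceAs (Module ℂ (PF d))

/-- The identity map into the space with the form given by the state. -/
def toPre : PF d ≃ₗ[ℂ] φ.PreGNS := LinearEquiv.refl ℂ _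

/-- The positive semidefinite form `⟨x, y⟩ = φ (x^* y)`. -/
abbrev preCore : PreInnerProductSpace.Core ℂ φ.PreGNS where
  inner a b := φ (star (φ.toPre.symm a) * φ.toPre.symm b)
  conj_inner_symm a b := by
    rw [← Complex.star_def, ← φ.map_star]; simp
  re_inner_nonneg a := (RCLike.nonneg_iff.mp (φ.nonneg' _)).1
  add_left _ _ _ := by rw [map_add, star_add, add_mul, map_add]
  smul_left := by simp

instance : SeminormedAddCommGroup φ.PreGNS :=
  InnerProductSpace.Core.toSeminormedAddCommGroup (c := φ.preCore)
instance : InnerProductSpace ℂ φ.PreGNS := InnerProductSpace.ofCore φ.preCore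

theorem inner_toPre (a b : PF d) : ⟪φ.toPre a, φ.toPre b⟫_ℂ = φ (star a * b) := rfl

/-- The GNS Hilbert space: the Hausdorff completion for the form `⟨x, y⟩ = φ (x^* y)`. -/
abbrev GNS : Type := UniformSpace.Completion φ.PreGNS

/-- Left multiplication. -/
def leftMul (a : PF d) : φ.PreGNS →ₗ[ℂ] φ.PreGNS :=
  φ.toPre.toLinearMap ∘ₗ LinearMap.mulLeft ℂ a ∘ₗ φ.toPre.symm.toLinearMap

@[simp]
theorem leftMul_toPre (a b : PF d) : φ.leftMul a (φ.toPre b) = φ.toPre (a * b) := rfl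

theorem leftMul_bound (a : PF d) : ∃ C : ℝ, ∀ x, ‖φ.leftMul a x‖ ≤ C * ‖x‖ := by
  suffices h : ∃ C : ℝ, 0 ≤ C ∧ ∀ x, ‖φ.leftMul a x‖ ≤ C * ‖x‖ from
    let ⟨C, _, hC⟩ := h; ⟨C, hC⟩
  induction a using PF.induction with
  | halg r =>
    refine ⟨‖r‖, norm_nonneg _, fun x => ?_⟩
    have : φ.leftMul (algebraMap ℂ (PF d) r) x = r • x :=
      (Algebra.smul_def r (φ.toPre.symm x)).symm
    rw [this, norm_smul]
  | hc j =>
    refine ⟨1, zero_le_one, fun x => ?_⟩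
    obtain ⟨b, rfl⟩ := φ.toPre.surjective x
    have hu := (Unitary.mem_iff.mp (PF.c_mem_unitary (d := d) j)).1
    rw [leftMul_toPre, one_mul, norm_eq_sqrt_re_inner (𝕜 := ℂ), norm_eq_sqrt_re_inner (𝕜 := ℂ),
      inner_toPre, inner_toPre, star_mul, mul_assoc, ← mul_assoc (star (PF.c d j)), hu, one_mul]
  | hmul a b ha hb =>
    obtain ⟨C, hC0, hC⟩ := ha
    obtain ⟨D, hD0, hD⟩ := hb
    refine ⟨C * D, mul_nonneg hC0 hD0, fun x => ?_⟩
    obtain ⟨y, rfl⟩ := φ.toPre.surjective x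
    have : φ.leftMul (a * b) (φ.toPre y) = φ.leftMul a (φ.leftMul b (φ.toPre y)) := by
      simp only [leftMul_toPre, mul_assoc]
    rw [this, mul_assoc]
    exact (hC _).trans (mul_le_mul_of_nonneg_left (hD _) hC0)
  | hadd a b ha hb =>
    obtain ⟨C, hC0, hC⟩ := ha
    obtain ⟨D, hD0, hD⟩ := hb
    refine ⟨C + D, add_nonneg hC0 hD0, fun x => ?_⟩
    obtain ⟨y, rfl⟩ := φ.toPre.surjective x
    have : φ.leftMul (a + b) (φ.toPre y) = φ.leftMul a (φ.toPre y) + φ.leftMul b (φ.toPre y) := by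
      simp only [leftMul_toPre, add_mul, map_add]
    rw [this, add_mul]
    exact (norm_add_le _ _).trans (add_le_add (hC _) (hD _))

/-- Left multiplication as a bounded operator. -/
def leftMulL (a : PF d) : φ.PreGNS →L[ℂ] φ.PreGNS :=
  (φ.leftMul a).mkContinuousOfExistsBound (φ.leftMul_bound a)

@[simp]
theorem leftMulL_toPre (a b : PF d) : φ.leftMulL a (φ.toPre b) = φ.toPre (a * b) := rfl

open UniformSpace.Completion ContinuousLinearMap in
/-- The GNS representation. -/
def π : PF d →⋆ₐ[ℂ] (φ.GNS →L[ℂ] φ.GNS) where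
  toFun a := (φ.leftMulL a).completion
  map_one' := by
    ext x
    induction x using induction_on with
    | hp => apply isClosed_eq <;> fun_prop
    | ih x =>
      obtain ⟨y, rfl⟩ := φ.toPre.surjective x
      simp
  map_mul' a b := by
    ext x
    induction x using induction_on with
    | hp => apply isClosed_eq <;> fun_prop
    | ih x =>
      obtain ⟨y, rfl⟩ := φ.toPre.surjective x
      simp [mul_assoc]
  map_zero' := by
    ext x
    induction x using induction_on with
    | hp => apply isClosed_eq <;> fun_prop
    | ih x =>
      obtain ⟨y, rfl⟩ := φ.toPre.surjective x
      have : φ.leftMulL 0 (φ.toPre y) = 0 := by simp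
      simp only [ContinuousLinearMap.completion_apply_coe, this, ContinuousLinearMap.zero_apply,
        coe_zero]
  map_add' a b := by
    ext x
    induction x using induction_on with
    | hp => apply isClosed_eq <;> fun_prop
    | ih x =>
      obtain ⟨y, rfl⟩ := φ.toPre.surjective x
      simp [add_mul, coe_add]
  commutes' r := by
    ext x
    induction x using induction_on with
    | hp => apply isClosed_eq <;> fun_prop
    | ih x =>
      obtain ⟨y, rfl⟩ := φ.toPre.surjective x
      simp [Algebra.algebraMap_eq_smul_one]
  map_star' a := by
    refine (eq_adjoint_iff (φ.leftMulL (star a)).completion (φ.leftMulL a).completion).mpr ?_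
    intro x y
    induction x, y using induction_on₂ with
    | hp => apply isClosed_eq <;> fun_prop
    | ih x y =>
      obtain ⟨x, rfl⟩ := φ.toPre.surjective x
      obtain ⟨y, rfl⟩ := φ.toPre.surjective y
      simp [mul_assoc, inner_toPre]

theorem π_coe (a b : PF d) :
    φ.π a ((φ.toPre b : φ.PreGNS) : φ.GNS) = ((φ.toPre (a * b) : φ.PreGNS) : φ.GNS) := by
  change (φ.leftMulL a).completion _ = _
  simp

/-- The GNS vector. -/
def Ω : φ.GNS := ((φ.toPre 1 : φ.PreGNS) : φ.GNS)

theorem π_Ω (a : PF d) : φ.π a φ.Ω = ((φ.toPre a : φ.PreGNS) : φ.GNS) := by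
  rw [Ω, π_coe, mul_one]

theorem inner_π_Ω (a : PF d) : ⟪φ.Ω, φ.π a φ.Ω⟫_ℂ = φ a := by
  rw [π_Ω, Ω, UniformSpace.Completion.inner_coe, inner_toPre, star_one, one_mul]

theorem denseRange_π_Ω : DenseRange fun a : PF d => φ.π a φ.Ω := by
  simp only [π_Ω]
  exact UniformSpace.Completion.denseRange_coe.comp φ.toPre.surjective.denseRange
    (UniformSpace.Completion.continuous_coe _)

/-! ### The tail algebra -/

/-- The von Neumann algebra `S''` generated by a set of operators (and their adjoints). -/
def _root_.Parafermion.vonNeumann {H : Type*} [NormedAddCommGroup H] [InnerProductSpace ℂ H]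
    [CompleteSpace H] (S : Set (H →L[ℂ] H)) : VonNeumannAlgebra H where
  toStarSubalgebra :=
    StarSubalgebra.centralizer ℂ (StarSubalgebra.centralizer ℂ S : Set (H →L[ℂ] H))
  centralizer_centralizer' := by
    change Set.centralizer (Set.centralizer (Set.centralizer _)) = Set.centralizer _
    simp

/-- The von Neumann algebra on the GNS space generated by `α^n (PF_∞)`, that is by the `c_j` with
`j ≥ 2n` (counted from zero). For `n = 0` it is the von Neumann algebra generated by the whole
parafermion algebra. -/
def shifted (n : ℕ) : VonNeumannAlgebra φ.GNS :=
  vonNeumann (Set.range fun a : PF d => φ.π ((PF.shift d)^[n] a))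

/-- The tail algebra, the intersection of the von Neumann algebras generated by
`α^n (PF_∞)`, `n ≥ 0`. -/
def tail : StarSubalgebra ℂ (φ.GNS →L[ℂ] φ.GNS) := ⨅ n, (φ.shifted n).toStarSubalgebra

/-- The part of charge `ℓ` of the tail algebra: the elements `x` with `c_1 x c_1^{-1} = q^ℓ x`. -/
def tailCharge (ℓ : ZMod d) : Submodule ℂ φ.tail where
  carrier := {x | φ.π (PF.c d 0) * (x : φ.GNS →L[ℂ] φ.GNS) * φ.π (star (PF.c d 0)) =
    q d ^ ℓ.val • (x : φ.GNS →L[ℂ] φ.GNS)}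
  add_mem' {x y} hx hy := by
    simp only [Set.mem_ofPred_eq] at hx hy ⊢
    simp [mul_add, add_mul, hx, hy]
  zero_mem' := by simp
  smul_mem' r x hx := by
    simp only [Set.mem_ofPred_eq] at hx ⊢
    simp [hx, smul_comm r]

end State

end Parafermion

end

noncomputable section

namespace Parafermion

/-! An element of the tail algebra commutes with every operator that commutes with all but finitely
many generators (`mem_tail_iff`). Feeding in suitable operators gives everything.

The operator `c_j^* c_0` commutes with every `c_k`, `k > j`, since the two phases cancel; hence all
generators act on the tail by the same automorphism (`conj_gen_eq_of_mem_tail`). Its order divides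
`d`, so the tail is the direct sum of its charge spaces. If `x` has charge `a`, then `x c_0^a`
commutes with every `c_k`, `k ≥ 1`, hence with the tail. This yields the exchange relation `y x =
q^{ab} x y` for `y` of charge `b` (`mul_eq_smul_mul_of_mem_tailCharge`).

When the neutral part is scalar, `x^* x` and `x x^*` are scalars for homogeneous `x`. So each
nonzero charge space contains a unitary, which spans it. The charges that occur form a subgroup of
`ℤ/d`, namely the multiples of some `m₀ ∣ d`. A unitary of charge `m₀` exchanged with itself gives
`q^{m₀²} = 1`, so `d ∣ m₀²`, and a gcd argument gives `p₀ ∣ m₀`. -/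

theorem PF.shift_iterate_c {d : ℕ} [NeZero d] (n j : ℕ) :
    (PF.shift d)^[n] (PF.c d j) = PF.c d (j + 2 * n) := by
  induction n generalizing j with
  | zero => rfl
  | succ n ih =>
    rw [Function.iterate_succ_apply, PF.shift_c, ih]
    congr 1
    ring

/-! ### Generators on the GNS space -/

namespace State

variable {d : ℕ} [NeZero d] (φ : State d)

/-- The operator on the GNS space which represents the generator `c_j`. -/
def gen (j : ℕ) : φ.GNS →L[ℂ] φ.GNS := φ.π (PF.c d j)

theorem gen_mul_gen {j k : ℕ} (h : j < k) :
    φ.gen j * φ.gen k = q d • (φ.gen k * φ.gen j) := by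
  simp only [gen, ← map_mul, ← map_smul, PF.c_mul_c h]

theorem star_gen_mul_gen (j : ℕ) : star (φ.gen j) * φ.gen j = 1 := by
  rw [gen, ← StarHomClass.map_star, ← map_mul, (Unitary.mem_iff.mp (PF.c_mem_unitary j)).1, map_one]

theorem gen_mul_star_gen (j : ℕ) : φ.gen j * star (φ.gen j) = 1 := by
  rw [gen, ← StarHomClass.map_star, ← map_mul, (Unitary.mem_iff.mp (PF.c_mem_unitary j)).2, map_one]

theorem gen_pow (j : ℕ) : φ.gen j ^ d = 1 := by
  rw [gen, ← map_pow, PF.c_pow, map_one]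

/-! ### Membership in the tail algebra -/

theorem commute_π_shift {T : φ.GNS →L[ℂ] φ.GNS} {n : ℕ}
    (h : ∀ k, 2 * n ≤ k → Commute T (φ.gen k)) (a : PF d) :
    Commute T (φ.π ((PF.shift d)^[n] a)) := by
  induction a using PF.induction with
  | halg r =>
    rw [Function.iterate_fixed (AlgHomClass.commutes (PF.shift d) r), AlgHomClass.commutes]
    exact Algebra.commute_algebraMap_right r T
  | hc j => exact PF.shift_iterate_c (d := d) n j ▸ h _ (by omega)
  | hmul a b ha hb =>
    rw [iterate_map_mul, map_mul]
    exact ha.mul_right hb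
  | hadd a b ha hb =>
    rw [iterate_map_add, map_add]
    exact ha.add_right hb

/-- The generators generate, and the image of the shifted algebra is self-adjoint, so the condition
on adjoints built into the star-centralizer is automatic. -/
theorem mem_centralizer_range_iff {T : φ.GNS →L[ℂ] φ.GNS} {n : ℕ} :
    T ∈ StarSubalgebra.centralizer ℂ (Set.range fun a : PF d => φ.π ((PF.shift d)^[n] a)) ↔
      ∀ k, 2 * n ≤ k → Commute T (φ.gen k) := by
  rw [StarSubalgebra.mem_centralizer_iff]
  constructor
  · intro h k hk
    have := (h _ ⟨PF.c d (k - 2 * n), rfl⟩).1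
    simp only [PF.shift_iterate_c, Nat.sub_add_cancel hk] at this
    exact this.symm
  · rintro h _ ⟨a, rfl⟩
    refine ⟨(φ.commute_π_shift h a).symm, ?_⟩
    have hs : star (φ.π ((PF.shift d)^[n] a)) = φ.π ((PF.shift d)^[n] (star a)) := by
      rw [← StarHomClass.map_star]
      congr 1
      exact (Function.Commute.iterate_right (f := star)
        (fun x => (StarHomClass.map_star (PF.shift d) x).symm) n) a
    simp only [hs]
    exact (φ.commute_π_shift h _).symm

/-- An operator is in the tail algebra exactly if it commutes with every operator which commutes
with all but finitely many of the generators. -/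
theorem mem_tail_iff {x : φ.GNS →L[ℂ] φ.GNS} :
    x ∈ φ.tail ↔ ∀ (n : ℕ) (T : φ.GNS →L[ℂ] φ.GNS),
      (∀ k, n ≤ k → Commute T (φ.gen k)) → Commute T x := by
  have key : x ∈ φ.tail ↔ ∀ n, ∀ T ∈ StarSubalgebra.centralizer ℂ
      (Set.range fun a : PF d => φ.π ((PF.shift d)^[n] a)), T * x = x * T ∧
        star T * x = x * star T := by
    rw [tail, StarSubalgebra.mem_iInf]
    exact forall_congr' fun n => StarSubalgebra.mem_centralizer_iff ℂ
  rw [key]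
  constructor
  · intro h n T hT
    -- Commuting from index `n` on implies commuting from `2 * n` on, so parity plays no role.
    exact (h n T ((φ.mem_centralizer_range_iff).mpr fun k hk => hT k (by omega))).1
  · intro h n T hT
    exact ⟨h _ T (φ.mem_centralizer_range_iff.mp hT),
      h _ (star T) (φ.mem_centralizer_range_iff.mp (star_mem hT))⟩

theorem commute_of_mem_tail {x T : φ.GNS →L[ℂ] φ.GNS} (hx : x ∈ φ.tail) (n : ℕ)
    (hT : ∀ k, n ≤ k → Commute T (φ.gen k)) : Commute T x :=
  φ.mem_tail_iff.mp hx n T hT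

/-! ### The gauge action -/

theorem conj_mul_conj (j : ℕ) (x y : φ.GNS →L[ℂ] φ.GNS) :
    φ.gen j * x * star (φ.gen j) * (φ.gen j * y * star (φ.gen j)) =
      φ.gen j * (x * y) * star (φ.gen j) := by
  calc _ = φ.gen j * x * (star (φ.gen j) * φ.gen j) * y * star (φ.gen j) := by
        simp only [mul_assoc]
    _ = _ := by rw [star_gen_mul_gen, mul_one]; simp only [mul_assoc]

theorem star_conj_gen {j k : ℕ} (h : j < k) :
    star (φ.gen j) * φ.gen k * φ.gen j = (q d)⁻¹ • φ.gen k := by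
  have h1 : φ.gen k * φ.gen j = (q d)⁻¹ • (φ.gen j * φ.gen k) := by
    rw [φ.gen_mul_gen h, smul_smul, inv_mul_cancel₀ PF.q_ne_zero, one_smul]
  rw [mul_assoc, h1, mul_smul_comm, ← mul_assoc, star_gen_mul_gen, one_mul]

theorem conj_gen {j k : ℕ} (h : j < k) :
    φ.gen j * φ.gen k * star (φ.gen j) = q d • φ.gen k := by
  rw [φ.gen_mul_gen h, smul_mul_assoc, mul_assoc, gen_mul_star_gen, mul_one]

/-- Conjugating the test operator `T` back by `c_j` gives another test operator, because `c_j`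
changes each later `c_k` only by a phase. -/
theorem conj_mem_tail {x : φ.GNS →L[ℂ] φ.GNS} (hx : x ∈ φ.tail) (j : ℕ) :
    φ.gen j * x * star (φ.gen j) ∈ φ.tail := by
  rw [mem_tail_iff]
  intro n T hT
  have hc : Commute (star (φ.gen j) * T * φ.gen j) x := by
    refine φ.commute_of_mem_tail hx (n + j + 1) fun k hk => ?_
    have hk' : j < k := by omega
    have h2 : T * φ.gen k = φ.gen k * T := hT k (by omega)
    have hq := PF.q_ne_zero (d := d)
    have h3 : φ.gen k = q d • (star (φ.gen j) * φ.gen k * φ.gen j) := by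
      rw [φ.star_conj_gen hk', smul_smul, mul_inv_cancel₀ hq, one_smul]
    rw [commute_iff_eq, h3, mul_smul_comm, smul_mul_assoc]
    congr 1
    calc star (φ.gen j) * T * φ.gen j * (star (φ.gen j) * φ.gen k * φ.gen j)
        = star (φ.gen j) * T * (φ.gen j * star (φ.gen j)) * φ.gen k * φ.gen j := by
          simp only [mul_assoc]
      _ = star (φ.gen j) * φ.gen k * (φ.gen j * star (φ.gen j)) * T * φ.gen j := by
          rw [gen_mul_star_gen, mul_one, mul_one, mul_assoc (star _), h2, ← mul_assoc]
      _ = _ := by simp only [mul_assoc]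
  have hT' : T = φ.gen j * (star (φ.gen j) * T * φ.gen j) * star (φ.gen j) := by
    calc T = (φ.gen j * star (φ.gen j)) * T * (φ.gen j * star (φ.gen j)) := by
          rw [gen_mul_star_gen, mul_one, one_mul]
      _ = _ := by simp only [mul_assoc]
  rw [hT', commute_iff_eq, conj_mul_conj, conj_mul_conj, hc.eq]

/-- All generators act on the tail algebra by the same automorphism. -/
theorem conj_gen_eq_of_mem_tail {x : φ.GNS →L[ℂ] φ.GNS} (hx : x ∈ φ.tail) (j : ℕ) :
    φ.gen j * x * star (φ.gen j) = φ.gen 0 * x * star (φ.gen 0) := by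
  -- Moving `c_k`, `k > j`, past `c_0` and past `c_j^*` produces inverse phases, so the product is a
  -- test operator.
  have hc : Commute (star (φ.gen j) * φ.gen 0) x := by
    refine φ.commute_of_mem_tail hx (j + 1) fun k hk => ?_
    have h0 : φ.gen 0 * φ.gen k = q d • (φ.gen k * φ.gen 0) := φ.gen_mul_gen (by omega)
    have hj : φ.gen k * star (φ.gen j) = q d • (star (φ.gen j) * φ.gen k) := by
      calc φ.gen k * star (φ.gen j)
          = star (φ.gen j) * (φ.gen j * φ.gen k * star (φ.gen j)) := by
            rw [← mul_assoc, ← mul_assoc, star_gen_mul_gen, one_mul]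
        _ = _ := by rw [φ.conj_gen (by omega), mul_smul_comm]
    rw [commute_iff_eq, mul_assoc, h0, mul_smul_comm, ← mul_assoc, ← mul_assoc, hj,
      smul_mul_assoc]
  calc φ.gen j * x * star (φ.gen j)
      = φ.gen j * (x * (star (φ.gen j) * φ.gen 0)) * star (φ.gen 0) := by
        rw [mul_assoc, mul_assoc, mul_assoc, mul_assoc, gen_mul_star_gen, mul_one]
    _ = (φ.gen j * star (φ.gen j)) * φ.gen 0 * x * star (φ.gen 0) := by
        rw [← hc.eq]; simp only [mul_assoc]
    _ = _ := by rw [gen_mul_star_gen, one_mul]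

/-- Conjugation by the first generator, as an endomorphism of the tail algebra. -/
def tailGauge : Module.End ℂ φ.tail where
  toFun x := ⟨φ.gen 0 * x * star (φ.gen 0), φ.conj_mem_tail x.2 0⟩
  map_add' x y := by ext1; simp [mul_add, add_mul]
  map_smul' r x := by ext1; simp

theorem coe_tailGauge (x : φ.tail) :
    (φ.tailGauge x : φ.GNS →L[ℂ] φ.GNS) = φ.gen 0 * x * star (φ.gen 0) := rfl

theorem tailGauge_pow_apply (n : ℕ) (x : φ.tail) :
    ((φ.tailGauge ^ n) x : φ.GNS →L[ℂ] φ.GNS) = φ.gen 0 ^ n * x * star (φ.gen 0) ^ n := by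
  induction n with
  | zero => simp
  | succ n ih =>
    rw [pow_succ', Module.End.mul_apply, coe_tailGauge, ih, pow_succ', pow_succ]
    simp only [mul_assoc]

theorem tailGauge_pow : φ.tailGauge ^ d = 1 := by
  ext x : 2
  rw [tailGauge_pow_apply, ← star_pow, gen_pow]
  simp

theorem mem_tailCharge_iff {ℓ : ZMod d} {x : φ.tail} :
    x ∈ φ.tailCharge ℓ ↔
      φ.gen 0 * (x : φ.GNS →L[ℂ] φ.GNS) * star (φ.gen 0) =
        q d ^ ℓ.val • (x : φ.GNS →L[ℂ] φ.GNS) := by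
  rw [gen, ← StarHomClass.map_star]
  exact Iff.rfl

/-- Reduces the charge grading to the spectral theory of one endomorphism of finite order. -/
theorem tailCharge_eq_eigenspace (ℓ : ZMod d) :
    φ.tailCharge ℓ = φ.tailGauge.eigenspace (q d ^ ℓ.val) := by
  ext x
  rw [Module.End.mem_eigenspace_iff, mem_tailCharge_iff, Subtype.ext_iff]
  rfl

end State

/-! ### Characters of `ℤ/d` and diagonalisation of endomorphisms of finite order -/

theorem q_pow_mod {d : ℕ} [NeZero d] (n : ℕ) : q d ^ (n % d) = q d ^ n :=
  (pow_eq_pow_mod n PF.q_pow).symm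

theorem q_pow_val_natCast {d : ℕ} [NeZero d] (n : ℕ) : q d ^ (n : ZMod d).val = q d ^ n := by
  rw [ZMod.val_natCast, q_pow_mod]

theorem q_pow_val_add {d : ℕ} [NeZero d] (a b : ZMod d) :
    q d ^ (a + b).val = q d ^ a.val * q d ^ b.val := by
  rw [ZMod.val_add, q_pow_mod, pow_add]

theorem q_pow_val_neg {d : ℕ} [NeZero d] (a : ZMod d) :
    q d ^ (-a).val = (q d ^ a.val)⁻¹ := by
  refine eq_inv_of_mul_eq_one_left ?_
  rw [← q_pow_val_add]
  simp

theorem q_pow_val_injective {d : ℕ} [NeZero d] :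
    Function.Injective fun a : ZMod d => q d ^ a.val := fun a b h =>
  ZMod.val_injective d (PF.isPrimitiveRoot_q.pow_inj a.val_lt b.val_lt h)

/-- An endomorphism of finite order dividing `d` is diagonalisable. -/
theorem iSup_eigenspace_eq_top_of_pow_eq_one {d : ℕ} [NeZero d] {M : Type*} [AddCommGroup M]
    [Module ℂ M] {f : Module.End ℂ M} (hf : f ^ d = 1) :
    ⨆ ℓ : ZMod d, f.eigenspace (q d ^ ℓ.val) = ⊤ := by
  rw [eq_top_iff]
  rintro x -
  have hq := PF.q_ne_zero (d := d)
  have hqi : (q d)⁻¹ ^ d = 1 := by rw [inv_pow, PF.q_pow, inv_one]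
  -- The discrete Fourier transform of the orbit of `x`: `y ℓ` is `d` times the spectral projection
  -- of `x`.
  let y : ℕ → M := fun ℓ => ∑ k ∈ Finset.range d, (q d)⁻¹ ^ (k * ℓ) • (f ^ k) x
  have hy : ∀ ℓ, y ℓ ∈ f.eigenspace (q d ^ ℓ) := fun ℓ => by
    rw [Module.End.mem_eigenspace_iff]
    have hper : ∀ k, (q d)⁻¹ ^ ((k + d) * ℓ) • (f ^ (k + d)) x
        = (q d)⁻¹ ^ (k * ℓ) • (f ^ k) x := fun k => by
      rw [add_mul, pow_add, pow_mul _ d, hqi, one_pow, mul_one, pow_add, hf, mul_one]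
    -- The summand has period `d` in `k`; applying `f` shifts the index by one, at the cost of a
    -- factor `q ^ ℓ`.
    have h1 := PF.sum_range_add_of_periodic
      (F := fun k => (q d)⁻¹ ^ (k * ℓ) • (f ^ k) x) hper 1
    simp only [y]
    conv_rhs => rw [← h1]
    rw [map_sum, Finset.smul_sum]
    refine Finset.sum_congr rfl fun k _ => ?_
    rw [map_smul, smul_smul, pow_succ', Module.End.mul_apply]
    congr 1
    rw [add_mul, one_mul, pow_add, mul_left_comm, ← mul_pow, mul_inv_cancel₀ hq, one_pow, mul_one]
  -- Fourier inversion: orthogonality of the characters leaves only the term `k = 0`.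
  have hsum : ∑ ℓ ∈ Finset.range d, y ℓ = (d : ℂ) • x := by
    simp only [y]
    rw [Finset.sum_comm]
    have : ∀ k ∈ Finset.range d, ∑ ℓ ∈ Finset.range d, (q d)⁻¹ ^ (k * ℓ) • (f ^ k) x
        = if k = 0 then (d : ℂ) • x else 0 := fun k hk => by
      rw [← Finset.sum_smul]
      simp_rw [mul_comm k]
      rw [PF.sum_pow_mul _ PF.isPrimitiveRoot_q.inv (Finset.mem_range.mp hk)]
      split_ifs with h
      · simp [h]
      · simp
    rw [Finset.sum_congr rfl this, Finset.sum_ite_eq' (Finset.range d) 0]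
    simp [NeZero.pos d]
  have hd : (d : ℂ) ≠ 0 := NeZero.ne _
  have hx : x = (d : ℂ)⁻¹ • ∑ ℓ ∈ Finset.range d, y ℓ := by
    rw [hsum, smul_smul, inv_mul_cancel₀ hd, one_smul]
  rw [hx]
  refine Submodule.smul_mem _ _ (Submodule.sum_mem _ fun ℓ _ => ?_)
  refine Submodule.mem_iSup_of_mem (ℓ : ZMod d) ?_
  rw [q_pow_val_natCast]
  exact hy ℓ

/-! ### The charge grading and the exchange relation -/

namespace State

variable {d : ℕ} [NeZero d] (φ : State d)

theorem iSup_tailCharge : ⨆ ℓ, φ.tailCharge ℓ = ⊤ := by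
  simp only [tailCharge_eq_eigenspace]
  exact iSup_eigenspace_eq_top_of_pow_eq_one φ.tailGauge_pow

theorem iSupIndep_tailCharge : iSupIndep φ.tailCharge := by
  have := (Module.End.eigenspaces_iSupIndep φ.tailGauge).comp (q_pow_val_injective (d := d))
  convert this using 1
  funext ℓ
  exact φ.tailCharge_eq_eigenspace ℓ

variable {φ}

theorem mul_mem_tailCharge {a b : ZMod d} {x y : φ.tail} (hx : x ∈ φ.tailCharge a)
    (hy : y ∈ φ.tailCharge b) : x * y ∈ φ.tailCharge (a + b) := by
  rw [mem_tailCharge_iff] at *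
  rw [MulMemClass.coe_mul, ← conj_mul_conj, hx, hy, smul_mul_smul_comm, q_pow_val_add]

theorem star_mem_tailCharge {a : ZMod d} {x : φ.tail} (hx : x ∈ φ.tailCharge a) :
    star x ∈ φ.tailCharge (-a) := by
  rw [mem_tailCharge_iff] at *
  have h := congrArg star hx
  rw [star_mul, star_mul, star_star, star_smul, star_pow, PF.star_q, inv_pow, ← mul_assoc] at h
  rw [q_pow_val_neg]
  exact h

theorem one_mem_tailCharge_zero : (1 : φ.tail) ∈ φ.tailCharge 0 := by
  rw [mem_tailCharge_iff]
  simp [gen_mul_star_gen]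

/-- The exchange relation between homogeneous elements of the tail algebra. -/
theorem mul_eq_smul_mul_of_mem_tailCharge {a b : ZMod d} {x y : φ.tail}
    (hx : x ∈ φ.tailCharge a) (hy : y ∈ φ.tailCharge b) :
    y * x = q d ^ (a.val * b.val) • (x * y) := by
  rw [mem_tailCharge_iff] at *
  have hpow : ∀ {z : φ.GNS →L[ℂ] φ.GNS} {r : ℂ}, φ.gen 0 * z = r • (z * φ.gen 0) → ∀ n : ℕ,
      φ.gen 0 ^ n * z = r ^ n • (z * φ.gen 0 ^ n) := fun h n => by
    simpa using PF.pow_mul_pow_of_comm h n 1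
  have hmove : ∀ {j : ℕ} {z : φ.GNS →L[ℂ] φ.GNS} {r : ℂ},
      φ.gen j * z * star (φ.gen j) = r • z → φ.gen j * z = r • (z * φ.gen j) := fun {j z r} h => by
    rw [← smul_mul_assoc, ← h, mul_assoc _ (star _), star_gen_mul_gen, mul_one]
  -- For `k ≥ 1` both `c_k x = q^a x c_k` and `c_0^a c_k = q^a c_k c_0^a`; the phases cancel in the
  -- product, which makes it a test operator for `y`.
  have hT : Commute ((x : φ.GNS →L[ℂ] φ.GNS) * φ.gen 0 ^ a.val) y := by
    refine φ.commute_of_mem_tail y.2 1 fun k hk => ?_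
    have h1 : φ.gen k * (x : φ.GNS →L[ℂ] φ.GNS) =
        q d ^ a.val • ((x : φ.GNS →L[ℂ] φ.GNS) * φ.gen k) :=
      hmove (by rw [φ.conj_gen_eq_of_mem_tail x.2, hx])
    have h2 : φ.gen 0 ^ a.val * φ.gen k = q d ^ a.val • (φ.gen k * φ.gen 0 ^ a.val) :=
      hpow (φ.gen_mul_gen (by omega)) _
    rw [commute_iff_eq, mul_assoc, h2, mul_smul_comm, ← mul_assoc, ← mul_assoc, h1, smul_mul_assoc]
  have h3 := hpow (hmove hy) a.val
  have h4 : (y : φ.GNS →L[ℂ] φ.GNS) * x * φ.gen 0 ^ a.val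
      = q d ^ (a.val * b.val) • ((x : φ.GNS →L[ℂ] φ.GNS) * y) * φ.gen 0 ^ a.val := by
    rw [mul_assoc, ← hT.eq, mul_assoc, h3, mul_smul_comm, smul_mul_assoc, ← mul_assoc, ← pow_mul,
      mul_comm b.val]
  have hu : φ.gen 0 ^ a.val * star (φ.gen 0) ^ a.val = 1 := by
    have hc : Commute (φ.gen 0) (star (φ.gen 0)) := by
      rw [commute_iff_eq, gen_mul_star_gen, star_gen_mul_gen]
    rw [← hc.mul_pow, gen_mul_star_gen, one_pow]
  -- The unitary `c_0^a` is cancelled on the right.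
  have h5 := congrArg (· * star (φ.gen 0) ^ a.val) h4
  simp only [mul_assoc _ (φ.gen 0 ^ a.val), hu, mul_one] at h5
  exact Subtype.ext h5

/-! ### Trivial neutral part -/

theorem norm_Ω : ‖φ.Ω‖ = 1 := by
  have h : ⟪φ.Ω, φ.Ω⟫_ℂ = 1 := by
    have := φ.inner_π_Ω 1
    rwa [map_one, one_apply_eq_self, φ.map_one'] at this
  rw [inner_self_eq_norm_sq_to_K] at h
  have h2 : ‖φ.Ω‖ ^ 2 = 1 := Complex.ofReal_injective (by simpa using h)
  exact (pow_eq_one_iff_of_nonneg (norm_nonneg _) two_ne_zero).mp h2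

instance : Nontrivial φ.tail := by
  refine ⟨0, 1, fun h => ?_⟩
  have h1 := congrArg (fun x : φ.tail => (x : φ.GNS →L[ℂ] φ.GNS) φ.Ω) h
  have h2 : φ.Ω = 0 := by simpa using h1.symm
  have := norm_Ω (φ := φ)
  simp [h2] at this

/-- If the neutral part is trivial, homogeneous nonzero elements are multiples of unitaries. -/
theorem exists_unitary_mem_tailCharge (h0 : φ.tailCharge 0 = Submodule.span ℂ {1}) {a : ZMod d}
    {x : φ.tail} (hx : x ∈ φ.tailCharge a) (hne : x ≠ 0) :
    ∃ u ∈ unitary φ.tail, u ∈ φ.tailCharge a := by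
  obtain ⟨r, hr⟩ : ∃ r : ℂ, r • (1 : φ.tail) = star x * x := by
    rw [← Submodule.mem_span_singleton, ← h0]
    simpa using mul_mem_tailCharge (star_mem_tailCharge hx) hx
  obtain ⟨s, hs⟩ : ∃ s : ℂ, s • (1 : φ.tail) = x * star x := by
    rw [← Submodule.mem_span_singleton, ← h0]
    simpa using mul_mem_tailCharge hx (star_mem_tailCharge hx)
  -- Both scalars come from bracketing `x x^* x`, with `x ≠ 0`.
  have hsr : s = r := by
    have h1 : s • x = r • x := by
      rw [← one_mul x, ← smul_mul_assoc, hs, mul_assoc, ← hr, mul_smul_comm, mul_one, one_mul]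
    exact smul_left_injective ℂ hne h1
  subst hsr
  let X : φ.GNS →L[ℂ] φ.GNS := x
  have hX : s • (1 : φ.GNS →L[ℂ] φ.GNS) = star X * X := congrArg Subtype.val hr
  -- The expectation of `x^* x = s` in the unit vector `Ω` is `‖x Ω‖²`, so `s` has a real square
  -- root, by which `x` is then normalised.
  obtain ⟨t, ht⟩ : ∃ t : ℝ, s = (t : ℂ) ^ 2 := by
    refine ⟨‖X φ.Ω‖, ?_⟩
    have h1 : ⟪φ.Ω, (star X * X) φ.Ω⟫_ℂ = (‖X φ.Ω‖ : ℂ) ^ 2 := by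
      rw [mul_apply_eq_comp, ContinuousLinearMap.star_eq_adjoint,
        ContinuousLinearMap.adjoint_inner_right, inner_self_eq_norm_sq_to_K]
      rfl
    rw [← h1, ← hX, smul_apply, one_apply_eq_self,
      inner_smul_right, inner_self_eq_norm_sq_to_K, norm_Ω]
    simp
  have hs0 : s ≠ 0 := by
    rintro rfl
    rw [zero_smul] at hX
    exact hne (Subtype.ext (CStarRing.star_mul_self_eq_zero_iff X |>.mp hX.symm))
  have ht0 : (t : ℂ) ≠ 0 := by
    intro h
    exact hs0 (by rw [ht, h]; simp)
  have hst : star ((t : ℂ)⁻¹) = (t : ℂ)⁻¹ := by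
    rw [star_inv₀, Complex.star_def, Complex.conj_ofReal]
  have htt : (t : ℂ)⁻¹ * (t : ℂ)⁻¹ * s = 1 := by rw [ht]; field_simp
  refine ⟨(t : ℂ)⁻¹ • x, ?_, Submodule.smul_mem _ _ hx⟩
  rw [Unitary.mem_iff, star_smul, hst, smul_mul_smul_comm, smul_mul_smul_comm, ← hr, ← hs,
    smul_smul, htt, one_smul]
  exact ⟨rfl, rfl⟩

/-- Multiplication by `u^*` sends charge `a` into the scalar neutral part, and `u` undoes it. -/
theorem tailCharge_eq_span (h0 : φ.tailCharge 0 = Submodule.span ℂ {1}) {a : ZMod d}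
    {u : φ.tail} (hu : u ∈ unitary φ.tail) (hua : u ∈ φ.tailCharge a) :
    φ.tailCharge a = Submodule.span ℂ {u} := by
  refine le_antisymm (fun y hy => ?_) ((Submodule.span_singleton_le_iff_mem _ _).mpr hua)
  have h1 : star u * y ∈ φ.tailCharge 0 := by
    simpa using mul_mem_tailCharge (star_mem_tailCharge hua) hy
  rw [h0, Submodule.mem_span_singleton] at h1
  obtain ⟨r, hr⟩ := h1
  rw [Submodule.mem_span_singleton]
  refine ⟨r, ?_⟩
  calc r • u = u * (r • 1) := by rw [mul_smul_comm, mul_one]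
    _ = y := by rw [hr, ← mul_assoc, (Unitary.mem_iff.mp hu).2, one_mul]

/-- The charges of unitary elements of the tail algebra. -/
def unitaryCharges (φ : State d) : AddSubgroup (ZMod d) where
  carrier := {a | ∃ u ∈ unitary φ.tail, u ∈ φ.tailCharge a}
  add_mem' := by
    rintro a b ⟨u, hu, hua⟩ ⟨v, hv, hvb⟩
    exact ⟨u * v, mul_mem hu hv, mul_mem_tailCharge hua hvb⟩
  zero_mem' := ⟨1, one_mem _, one_mem_tailCharge_zero⟩
  neg_mem' := by
    rintro a ⟨u, hu, hua⟩
    exact ⟨star u, Unitary.star_mem hu, star_mem_tailCharge hua⟩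

/-- Exchanging a unitary `u` of charge `a` with itself gives `u² = q^{a²} u²`, and `u² ≠ 0`. -/
theorem dvd_val_sq_of_mem_unitaryCharges {a : ZMod d} (ha : a ∈ unitaryCharges φ) :
    d ∣ a.val ^ 2 := by
  obtain ⟨u, hu, hua⟩ := ha
  have h := mul_eq_smul_mul_of_mem_tailCharge hua hua
  have hne : u * u ≠ 0 := fun h1 => one_ne_zero (α := φ.tail) <| by
    have h2 := (Unitary.mem_iff.mp (mul_mem hu hu)).1
    rw [← h2, h1, mul_zero]
  have h1 : q d ^ (a.val * a.val) = 1 := by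
    refine (smul_left_injective ℂ hne ?_).symm
    simpa using h
  rw [sq]
  exact PF.isPrimitiveRoot_q.dvd_of_pow_eq_one _ h1

end State

/-! ### Arithmetic of the possible charges -/

/-- A subgroup of `ℤ/d` consists of the multiples of a divisor of `d`. -/
theorem exists_dvd_forall_mem_addSubgroup_iff {d : ℕ} (G : AddSubgroup (ZMod d)) :
    ∃ m : ℕ, m ∣ d ∧ ∀ n : ℕ, (n : ZMod d) ∈ G ↔ m ∣ n := by
  obtain ⟨a, ha⟩ := Int.subgroup_cyclic (G.comap (Int.castAddHom (ZMod d)))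
  have key : ∀ n : ℕ, (n : ZMod d) ∈ G ↔ a.natAbs ∣ n := fun n => by
    have h1 : ((n : ℤ) ∈ G.comap (Int.castAddHom (ZMod d))) ↔ (n : ZMod d) ∈ G := by simp
    rw [← h1, ha, ← AddSubgroup.zmultiples_eq_closure, Int.mem_zmultiples_iff,
      ← Int.natAbs_dvd_natAbs, Int.natAbs_natCast]
  -- The generator divides `d` because the class of `d` is zero and so lies in `G`.
  exact ⟨a.natAbs, (key d).mp (by simp), key⟩

/-- The least `p > 0` with `d ∣ p ^ 2` divides every such `p`. -/
theorem dvd_of_isLeast_of_dvd_sq {d p₀ m : ℕ} (hp₀ : IsLeast {p : ℕ | 0 < p ∧ d ∣ p ^ 2} p₀)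
    (hm : d ∣ m ^ 2) : p₀ ∣ m := by
  obtain ⟨⟨h0, hd⟩, hle⟩ := hp₀
  -- The gcd of squares is the square of the gcd, so minimality of `p₀` applies to `gcd p₀ m`.
  have hg : d ∣ (Nat.gcd p₀ m) ^ 2 := by
    rw [← Nat.pow_gcd_pow]
    exact Nat.dvd_gcd hd hm
  have h1 : p₀ ≤ Nat.gcd p₀ m := hle ⟨Nat.gcd_pos_of_pos_left _ h0, hg⟩
  exact (Nat.gcd_eq_left_iff_dvd).mp (le_antisymm (Nat.gcd_le_left _ h0) h1)

/-- Cancelling `m` leaves a congruence modulo `d / m`, and the interval from `1` to `d / m` meets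
each residue class once. -/
theorem injective_natCast_mul {d m : ℕ} (hd : 0 < d) (hm : m ∣ d) :
    Function.Injective fun j : Finset.Icc 1 (d / m) => ((j * m : ℕ) : ZMod d) := by
  obtain ⟨e, rfl⟩ := hm
  have hm0 : 0 < m := Nat.pos_of_mul_pos_right hd
  rintro ⟨i, hi⟩ ⟨j, hj⟩ h
  rw [Nat.mul_div_cancel_left _ hm0, Finset.mem_Icc] at hi hj
  rw [ZMod.natCast_eq_natCast_iff, mul_comm i, mul_comm j] at h
  have h2 := Nat.ModEq.mul_left_cancel' hm0.ne' h
  rw [Subtype.mk.injEq]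
  have h3 : (i : ℤ) ≡ j [ZMOD e] := by exact_mod_cast h2
  obtain ⟨c, hc⟩ := h3.dvd
  have : c = 0 := by
    have he : (0 : ℤ) < e := by omega
    have h4 : (e : ℤ) * c < e * 1 := by omega
    have h5 : (e : ℤ) * (-1) < e * c := by omega
    have := lt_of_mul_lt_mul_left h4 he.le
    have := lt_of_mul_lt_mul_left h5 he.le
    omega
  subst this
  omega

end Parafermion

end

/-- Strings, hence parafermions, are counted from zero. -/
theorem mainTheorem8 (d : ℕ) [NeZero d] (p₀ : ℕ) (hp₀ : IsLeast {p : ℕ | 0 < p ∧ d ∣ p ^ 2} p₀)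
    (φ : Parafermion.State d) (hφ : φ.BraidInvariant)
    (hneutral : φ.tailCharge 0 = Submodule.span ℂ {1}) :
    ∃ m₀ : ℕ, p₀ ∣ m₀ ∧ m₀ ∣ d ∧
      DirectSum.IsInternal
        (fun j : Finset.Icc 1 (d / m₀) => φ.tailCharge (((j : ℕ) * m₀ : ℕ) : ZMod d)) ∧
      ∀ j ∈ Finset.Icc 1 (d / m₀),
        Module.finrank ℂ (φ.tailCharge ((j * m₀ : ℕ) : ZMod d)) = 1 ∧
        ∃ u ∈ unitary φ.tail,
          φ.tailCharge ((j * m₀ : ℕ) : ZMod d) = Submodule.span ℂ {u} := by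
  have hd : 0 < d := NeZero.pos d
  obtain ⟨m, hmd, hm⟩ := Parafermion.exists_dvd_forall_mem_addSubgroup_iff φ.unitaryCharges
  have hm0 : 0 < m := Nat.pos_of_dvd_of_pos hmd hd
  have hsq : d ∣ m ^ 2 := by
    have h := Parafermion.State.dvd_val_sq_of_mem_unitaryCharges ((hm m).mpr dvd_rfl)
    -- The representative is `m % d`, which is `0` rather than `m` when `m = d`; the divisibility
    -- transfers to `m` modulo `d`.
    rw [ZMod.val_natCast] at h
    exact (Nat.modEq_zero_iff_dvd.mp
      (((Nat.mod_modEq m d).pow 2).symm.trans (Nat.modEq_zero_iff_dvd.mpr h)))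
  refine ⟨m, Parafermion.dvd_of_isLeast_of_dvd_sq hp₀ hsq, hmd, ?_, fun j _ => ?_⟩
  · refine DirectSum.isInternal_submodule_of_iSupIndep_of_iSup_eq_top
      (φ.iSupIndep_tailCharge.comp (Parafermion.injective_natCast_mul hd hmd)) ?_
    rw [eq_top_iff, ← φ.iSup_tailCharge]
    -- Charges outside the subgroup contribute nothing: a nonzero `x` of charge `ℓ` would yield a
    -- unitary of that charge.
    refine iSup_le fun ℓ x hx => ?_
    by_cases hne : x = 0
    · exact hne ▸ zero_mem _
    have hℓ : ((ℓ.val : ℕ) : ZMod d) ∈ φ.unitaryCharges := by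
      rw [ZMod.natCast_zmod_val]
      exact Parafermion.State.exists_unitary_mem_tailCharge hneutral hx hne
    obtain ⟨i, hi⟩ := (hm _).mp hℓ
    obtain ⟨j, hj, hjℓ⟩ : ∃ j ∈ Finset.Icc 1 (d / m), ((j * m : ℕ) : ZMod d) = ℓ := by
      rcases Nat.eq_zero_or_pos i with h0 | h0
      -- The index starts at `1`, so the neutral charge is represented by the last index, where `j *
      -- m = d`.
      · refine ⟨d / m, Finset.mem_Icc.mpr ⟨Nat.div_pos (Nat.le_of_dvd hd hmd) hm0, le_rfl⟩, ?_⟩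
        have : ℓ = 0 := by rwa [h0, mul_zero, ZMod.val_eq_zero] at hi
        rw [Nat.div_mul_cancel hmd, this, ZMod.natCast_self]
      · refine ⟨i, Finset.mem_Icc.mpr ⟨h0, ?_⟩, ?_⟩
        · rw [Nat.le_div_iff_mul_le hm0, mul_comm, ← hi]
          exact ℓ.val_lt.le
        · rw [mul_comm, ← hi, ZMod.natCast_zmod_val]
    exact Submodule.mem_iSup_of_mem (⟨j, hj⟩ : Finset.Icc 1 (d / m)) (by rwa [hjℓ])
  · obtain ⟨u, hu, huc⟩ := (hm (j * m)).mpr (dvd_mul_left m j)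
    have hspan := Parafermion.State.tailCharge_eq_span hneutral hu huc
    refine ⟨?_, u, hu, hspan⟩
    rw [hspan]
    refine finrank_span_singleton fun h0 => one_ne_zero (α := φ.tail) ?_
    rw [← (Unitary.mem_iff.mp hu).1, h0, mul_zero]
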